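/- Rings are associative and unital. For a ring $R$, let $\mathsf{D}(R)$ be the unbounded derived category of the category of right $R$-modules, and regard modules as complexes concentrated in degree $0$. A localizing subcategory of a triangulated category with set-indexed coproducts is a (strictly full) triangulated subcategory closed under set-indexed coproducts. We say that injectives generate for $R$ if the smallest localizing subcategory of $\mathsf{D}(R)$ containing all injective right $R$-modules is $\mathsf{D}(R)$ itself. Let $\Gamma$ be a finite abelian group and let $R=\bigoplus_{\gamma\in\Gamma}R_\gamma$ be a strongly $\Gamma$-graded ring, that is, a $\Gamma$-graded ring such that $R_\gamma\cdot R_{\gamma'}=R_{\gamma+\gamma'}$ for all $\gamma,\gamma'\in\Gamma$, where $R_\gamma\cdot R_{\gamma'}$ denotes the additive subgroup generated by the products $xy$ with $x\in R_\gamma$, $y\in R_{\gamma'}$. Then injectives generate for $R$ if and only if injectives generate for the subring $R_0$. -/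

import Mathlib

open CategoryTheory

universe w v u

section Localizing

variable {T : Type u} [Category.{v} T] [Limits.HasZeroObject T] [HasShift T ℤ]
  [Preadditive T] [∀ n : ℤ, (shiftFunctor T n).Additive] [Pretriangulated T]

/-- `P` is (the class of objects of) a localizing subcategory of the triangulated category `T`:
a strictly full triangulated subcategory closed under small coproducts, i.e. coproducts of
families indexed by `I : Type w`. -/
structure IsLocalizingSubcategory (P : ObjectProperty T) : Prop where
  isTriangulated : P.IsTriangulated
  isClosedUnderIsomorphisms : P.IsClosedUnderIsomorphisms
  isClosedUnderCoproducts : ∀ I : Type w, P.IsClosedUnderColimitsOfShape (Discrete I)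

/-- `Loc(S)`: the smallest localizing subcategory of `T` containing the class of objects `S`,
given as the intersection of all the localizing subcategories containing `S`. -/
def localizingClosure (S : ObjectProperty T) : ObjectProperty T :=
  fun X => ∀ P : ObjectProperty T, IsLocalizingSubcategory.{w} P → S ≤ P → P X

end Localizing

section Injectives

attribute [local instance] HasDerivedCategory.standard

/-- The derived category `D(R)` of the category of right `R`-modules (that is, of left modules
over the opposite ring). -/
abbrev DerivedCategoryOfRightModules (R : Type u) [Ring R] : Type (u + 1) :=
  DerivedCategory (ModuleCat.{u} Rᵐᵒᵖ)

/-- `Inj R` in `D(R)`: the objects isomorphic to an injective right `R`-module, considered as a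
complex concentrated in degree `0`. -/
def injectiveRightModules (R : Type u) [Ring R] :
    ObjectProperty (DerivedCategoryOfRightModules R) :=
  fun X => ∃ M : ModuleCat.{u} Rᵐᵒᵖ, Injective M ∧
    Nonempty (X ≅ (DerivedCategory.singleFunctor (ModuleCat.{u} Rᵐᵒᵖ) 0).obj M)

/-- Injectives generate for `R`: `Loc(Inj R) = D(R)`. -/
def InjectivesGenerate (R : Type u) [Ring R] : Prop :=
  localizingClosure.{u} (injectiveRightModules R) = ⊤

end Injectives

/-- A family of additive subgroups grading a ring `R` is a strong grading if
`R_a · R_b = R_(a + b)`, where `R_a · R_b` is the additive subgroup generated by the products. -/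
def IsStronglyGraded {Γ : Type v} [Add Γ] {R : Type u} [Ring R] (𝒜 : Γ → AddSubgroup R) : Prop :=
  ∀ a b : Γ, AddSubgroup.closure (Set.image2 (fun x y : R => x * y) (𝒜 a) (𝒜 b)) = 𝒜 (a + b)

/-!
# Generation by injectives for strongly graded rings

The inclusion `R₀ → R` of the degree zero part of a ring strongly graded by a finite group is a
Frobenius extension (`IsStronglyGraded.exists_frobeniusSystem`): the projection `E : R → R₀` is a
bimodule map, and writing `1 = ∑ xᵢ yᵢ` with `xᵢ ∈ R_{-γ}` and `yᵢ ∈ R_γ` for each degree `γ` gives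
dual bases for `E`. Consequently coextension of scalars `F` is not only a right adjoint but also a
left adjoint of restriction of scalars `G` (`FrobeniusSystem.adjunction`). Both functors are
therefore exact, preserve injectives, and induce triangulated functors between the derived
categories which are left adjoints and hence preserve coproducts. So the preimage under `F` or `G`
of a localizing subcategory containing the injectives is again of this kind.

* If injectives generate for `R`, every `G N` lies in each localizing subcategory `P` of `D(R₀)`
  containing the injectives. As `E 1 = 1`, every complex `X` over `R₀` is a retract of `G (F X)`,
  and `P` is closed under retracts (`prop_of_retract_of_countable_coproducts`).

* If injectives generate for `R₀`, every `F X` lies in each localizing subcategory `P` of `D(R)`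
  containing the injectives. Since `G` is conservative and preserves coproducts, this forces `P`
  to be everything (`prop_of_prop_leftAdjoint_obj`): iterating the cone of the counit `F (G N) → N`
  yields a sequence `N = X₀ → X₁ → X₂ → ⋯` of isomorphisms modulo `P` whose homotopy colimit
  vanishes, as its transition maps are killed by `G`; but modulo `P` this homotopy colimit is `N`.

These arguments need countable coproducts in the derived category, which are computed by coproducts
of complexes (`DerivedCategory.isColimitQMapSigma`) because coproducts of modules are exact.
-/

/-! ### Localizing subcategories of triangulated categories -/

section Triangulated

open Limits Pretriangulated

variable {T : Type*} [Category* T] [HasZeroObject T] [HasShift T ℤ]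
  [Preadditive T] [∀ n : ℤ, (shiftFunctor T n).Additive] [Pretriangulated T]

/-- The class of morphisms whose cone lies in `P` is closed under the coproducts under which `P`
is closed: a cone of `∐ f` is isomorphic to the coproduct of the cones. -/
lemma trW_sigmaMap {J : Type*} [HasCoproductsOfShape J T] (P : ObjectProperty T)
    [P.IsClosedUnderIsomorphisms] [P.IsClosedUnderColimitsOfShape (Discrete J)]
    {X Y : J → T} (f : ∀ j, X j ⟶ Y j) (hf : ∀ j, P.trW (f j)) :
    P.trW (Limits.Sigma.map f) := by
  have exact₂ : ∀ {A B C D : T} {a : A ⟶ B} {b : B ⟶ C} {c : C ⟶ A⟦(1 : ℤ)⟧}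
      (_ : Triangle.mk a b c ∈ distTriang T) (k : B ⟶ D), a ≫ k = 0 → ∃ l, k = b ≫ l :=
    fun hT k hk => Triangle.yoneda_exact₂ _ hT k hk
  have exact₃ : ∀ {A B C D : T} {a : A ⟶ B} {b : B ⟶ C} {c : C ⟶ A⟦(1 : ℤ)⟧}
      (_ : Triangle.mk a b c ∈ distTriang T) (k : C ⟶ D), b ≫ k = 0 → ∃ l, k = c ≫ l :=
    fun hT k hk => Triangle.yoneda_exact₃ _ hT k hk
  choose Z g h hT hZ using hf
  obtain ⟨Z', f₂, f₃, hT'⟩ := distinguished_cocone_triangle (Limits.Sigma.map f)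
  have key : ∀ j, ∃ c : Z j ⟶ Z', g j ≫ c = Sigma.ι Y j ≫ f₂ ∧
      h j ≫ (Sigma.ι X j)⟦1⟧' = c ≫ f₃ := fun j =>
    complete_distinguished_triangle_morphism _ _ (hT j) hT' (Sigma.ι X j) (Sigma.ι Y j)
      (Sigma.ι_map f j).symm
  choose c hc₂ hc₃ using key
  have shiftX := isColimitCofanMkObjOfIsColimit (shiftFunctor T (1 : ℤ)) _ _
    (coproductIsCoproduct X)
  have shiftY := isColimitCofanMkObjOfIsColimit (shiftFunctor T (1 : ℤ)) _ _
    (coproductIsCoproduct Y)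
  have descX : ∀ {A : T} (k : ∀ j, (X j)⟦(1 : ℤ)⟧ ⟶ A),
      ∃ l : (∐ X)⟦(1 : ℤ)⟧ ⟶ A, ∀ j, (Sigma.ι X j)⟦1⟧' ≫ l = k j :=
    fun k => ⟨Cofan.IsColimit.desc shiftX k, fun j => Cofan.IsColimit.fac shiftX k j⟩
  have descY : ∀ {A : T} (k : ∀ j, (Y j)⟦(1 : ℤ)⟧ ⟶ A),
      ∃ l : (∐ Y)⟦(1 : ℤ)⟧ ⟶ A, ∀ j, (Sigma.ι Y j)⟦1⟧' ≫ l = k j :=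
    fun k => ⟨Cofan.IsColimit.desc shiftY k, fun j => Cofan.IsColimit.fac shiftY k j⟩
  have extX : ∀ {A : T} (k l : (∐ X)⟦(1 : ℤ)⟧ ⟶ A),
      (∀ j, (Sigma.ι X j)⟦1⟧' ≫ k = (Sigma.ι X j)⟦1⟧' ≫ l) → k = l :=
    fun k l hkl => Cofan.IsColimit.hom_ext shiftX _ _ hkl
  have hgf : ∀ j, f j ≫ g j = 0 := fun j => comp_distTriang_mor_zero₁₂ _ (hT j)
  have h31 : f₃ ≫ (Limits.Sigma.map f)⟦1⟧' = 0 := comp_distTriang_mor_zero₃₁ _ hT'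
  let φ : ∐ Z ⟶ Z' := Sigma.desc c
  have : IsIso φ := by
    refine isIso_of_coyoneda_map_bijective _ (fun A => ⟨?_, ?_⟩)
    · suffices Epi φ by
        intro a₁ a₂ ha
        simpa only [← cancel_epi φ] using ha
      rw [Preadditive.epi_iff_cancel_zero]
      intro A a ha
      have ha' : ∀ j, c j ≫ a = 0 := fun j => by
        simpa [φ] using Sigma.ι Z j ≫= ha
      obtain ⟨b, rfl⟩ := exact₃ hT' a (by
        ext j
        rw [← reassoc_of% (hc₂ j), ha', comp_zero, comp_zero])
      have hb : ∀ j, ∃ k : (Y j)⟦(1 : ℤ)⟧ ⟶ A, (Sigma.ι X j)⟦1⟧' ≫ b = (f j)⟦1⟧' ≫ k := by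
        intro j
        obtain ⟨k, hk⟩ := exact₃ (b := h j) (c := -(f j)⟦(1 : ℤ)⟧')
          (rot_of_distTriang _ (hT j)) ((Sigma.ι X j)⟦1⟧' ≫ b) (by
            rw [reassoc_of% (hc₃ j), ha' j])
        exact ⟨-k, by rw [hk, Preadditive.neg_comp, Preadditive.comp_neg]⟩
      choose k hk using hb
      obtain ⟨l, hl⟩ := descY k
      have : b = (Limits.Sigma.map f)⟦1⟧' ≫ l := by
        apply extX
        intro j
        rw [hk, ← Functor.map_comp_assoc, Sigma.ι_map, Functor.map_comp_assoc, hl]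
      rw [this, reassoc_of% h31, zero_comp]
    · intro a
      obtain ⟨a', ha'⟩ := exact₂ hT' (Limits.Sigma.map g ≫ a) (by
        ext j
        simp [reassoc_of% (hgf j)])
      have hb : ∀ j, ∃ b : (X j)⟦(1 : ℤ)⟧ ⟶ A, Sigma.ι Z j ≫ a - c j ≫ a' = h j ≫ b := fun j =>
        exact₃ (hT j) (Sigma.ι Z j ≫ a - c j ≫ a') (by
          rw [Preadditive.comp_sub, reassoc_of% (hc₂ j), ← ha', Sigma.ι_map_assoc, sub_self])
      choose b hb using hb
      obtain ⟨l, hl⟩ := descX b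
      refine ⟨a' + f₃ ≫ l, ?_⟩
      dsimp [φ]
      ext j
      rw [colimit.ι_desc_assoc]
      dsimp
      rw [Preadditive.comp_add, ← reassoc_of% (hc₃ j), hl, ← hb, add_sub_cancel]
  exact ⟨Z', f₂, f₃, hT', P.prop_of_iso (asIso φ)
    (P.prop_colimit _ fun j => hZ j.as)⟩

/-- If the direct sum inclusion `s : A ⟶ B` of a complement of `X` has its cone in `P`, then `X`
is in `P`. -/
lemma prop_of_trW_of_split (P : ObjectProperty T) [P.IsClosedUnderIsomorphisms] {A B X : T}
    (s : A ⟶ B) (r : B ⟶ A) (q : B ⟶ X) (j : X ⟶ B) (hsr : s ≫ r = 𝟙 A) (hjq : j ≫ q = 𝟙 X)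
    (total : r ≫ s + q ≫ j = 𝟙 B) (hs : P.trW s) : P X := by
  have hsqj : s ≫ q ≫ j = 0 := by
    have := s ≫= total
    rw [Preadditive.comp_add, reassoc_of% hsr, Category.comp_id] at this
    simpa using this
  have hsq : s ≫ q = 0 := by
    have := hsqj =≫ q
    simpa [hjq] using this
  have hjr : j ≫ r = 0 := by
    have := total =≫ r
    rw [Preadditive.add_comp, Category.assoc, hsr, Category.comp_id, Category.id_comp] at this
    have h : q ≫ j ≫ r = 0 := by simpa using this
    have := j ≫= h
    simpa [reassoc_of% hjq] using this
  let e : B ≅ A ⊞ X :=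
    { hom := biprod.lift r q
      inv := biprod.desc s j
      hom_inv_id := by simpa using total
      inv_hom_id := by
        ext <;> simp [hsr, hsq, hjr, hjq] }
  have he : s ≫ e.hom = biprod.inl := by
    ext <;> simp [e, hsr, hsq]
  have : P.trW (biprod.inl : A ⟶ A ⊞ X) := by
    rw [← he]
    have : IsIso e.hom := e.isIso_hom
    exact (MorphismProperty.cancel_right_of_respectsIso P.trW s e.hom).2 hs
  exact (P.trW_iff_of_distinguished _ (binaryBiproductTriangle_distinguished A X)).1 this

/-- A triangulated subcategory closed under countable coproducts is closed under retracts, by the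
Eilenberg swindle. -/
lemma prop_of_retract_of_countable_coproducts [HasCoproductsOfShape ℕ T] (P : ObjectProperty T)
    [P.IsTriangulated] [P.IsClosedUnderIsomorphisms]
    [P.IsClosedUnderColimitsOfShape (Discrete ℕ)] {X Y : T} (i : X ⟶ Y) (p : Y ⟶ X)
    (hip : i ≫ p = 𝟙 X) (hY : P Y) : P X := by
  let Z : ℕ → T := fun _ => Y
  let e : Y ⟶ Y := p ≫ i
  have hee : e ≫ e = e := by simp [e, reassoc_of% hip]
  have hie : i ≫ e = i := by simp [e, reassoc_of% hip]
  have hep : e ≫ p = p := by simp [e, hip]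
  -- With `Y = X ⊕ X'`, the endomorphism `s` of `∐ Z` fixes all copies of `X'` and moves each copy
  -- of `X` one step up, so that its cokernel is the copy of `X` in position `0`.
  let s : ∐ Z ⟶ ∐ Z := Sigma.desc fun n => (𝟙 Y - e) ≫ Sigma.ι Z n + e ≫ Sigma.ι Z (n + 1)
  let r : ∐ Z ⟶ ∐ Z := Sigma.desc fun n => (𝟙 Y - e) ≫ Sigma.ι Z n +
    Nat.casesOn n 0 fun m => e ≫ Sigma.ι Z m
  let q : ∐ Z ⟶ X := Sigma.desc fun n => Nat.casesOn n p fun _ => 0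
  have hs : ∀ n, Sigma.ι Z n ≫ s = (𝟙 Y - e) ≫ Sigma.ι Z n + e ≫ Sigma.ι Z (n + 1) :=
    fun n => by simp [s]
  have hr₀ : Sigma.ι Z 0 ≫ r = (𝟙 Y - e) ≫ Sigma.ι Z 0 := by simp [r]
  have hr₁ : ∀ n, Sigma.ι Z (n + 1) ≫ r = (𝟙 Y - e) ≫ Sigma.ι Z (n + 1) + e ≫ Sigma.ι Z n :=
    fun n => by simp [r]
  have hq₀ : Sigma.ι Z 0 ≫ q = p := by simp [q]
  have hq₁ : ∀ n, Sigma.ι Z (n + 1) ≫ q = 0 := fun n => by simp [q]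
  have hsum : P (∐ Z) := P.prop_colimit _ fun _ => hY
  have h1e : (𝟙 Y - e) ≫ e = 0 := by simp [hee]
  have he1 : e ≫ (𝟙 Y - e) = 0 := by simp [hee]
  have h11 : (𝟙 Y - e) ≫ (𝟙 Y - e) = 𝟙 Y - e := by simp [hee]
  refine prop_of_trW_of_split P s r q (i ≫ Sigma.ι Z 0) ?_ ?_ ?_ ?_
  · ext n
    rw [reassoc_of% (hs n), Preadditive.add_comp, Category.assoc, Category.assoc, hr₁,
      Category.comp_id, Preadditive.comp_add, reassoc_of% he1, reassoc_of% hee, zero_comp,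
      zero_add]
    cases n with
    | zero => rw [hr₀, reassoc_of% h11, ← Preadditive.add_comp, sub_add_cancel, Category.id_comp]
    | succ n =>
      rw [hr₁, Preadditive.comp_add, reassoc_of% h11, reassoc_of% h1e, zero_comp, add_zero,
        ← Preadditive.add_comp, sub_add_cancel, Category.id_comp]
  · rw [Category.assoc, hq₀, hip]
  · ext n
    rw [Preadditive.comp_add, Category.comp_id]
    cases n with
    | zero =>
      rw [reassoc_of% hr₀, hs, Preadditive.comp_add, reassoc_of% h11, reassoc_of% h1e, zero_comp,
        add_zero, reassoc_of% hq₀, ← Category.assoc p i, ← Preadditive.add_comp, sub_add_cancel,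
        Category.id_comp]
    | succ n =>
      rw [reassoc_of% (hr₁ n), reassoc_of% (hq₁ n), Preadditive.add_comp, Category.assoc,
        Category.assoc, hs, hs, Preadditive.comp_add, Preadditive.comp_add, reassoc_of% h11,
        reassoc_of% h1e, reassoc_of% he1, reassoc_of% hee, zero_comp, zero_comp, zero_comp,
        add_zero, add_zero, zero_add, ← Preadditive.add_comp, sub_add_cancel, Category.id_comp]
  · obtain ⟨C, a, b, hT⟩ := distinguished_cocone_triangle s
    exact ⟨C, a, b, hT, P.ext_of_isTriangulatedClosed₃ _ hT hsum hsum⟩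

variable [IsTriangulated T]

lemma trW_of_comp_of_trW (P : ObjectProperty T) [P.IsTriangulated] [P.IsClosedUnderIsomorphisms]
    {X Y Z : T} (f : X ⟶ Y) (g : Y ⟶ Z) (hg : P.trW g) (hfg : P.trW (f ≫ g)) : P.trW f := by
  obtain ⟨C₂, v₂, w₂, h₂, m₂⟩ := hg
  obtain ⟨C₃, v₃, w₃, h₃, m₃⟩ := hfg
  obtain ⟨C₁, v₁, w₁, h₁⟩ := distinguished_cocone_triangle f
  exact ⟨C₁, v₁, w₁, h₁, P.ext_of_isTriangulatedClosed₁ _ (Triangulated.someOctahedron rfl h₁ h₂ h₃).mem m₃ m₂⟩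

/-- If a right adjoint functor `G` is conservative and preserves countable coproducts, then the
image of its left adjoint `F` generates: a triangulated subcategory closed under countable
coproducts that contains all the `F.obj X` contains everything.

The cones `X₀ = N`, `X₁`, … of the successive counits `F.obj (G.obj Xₙ) ⟶ Xₙ` are linked by
morphisms `Xₙ ⟶ Xₙ₊₁` which become invertible modulo `P` but are killed by `G`. The first property
identifies the telescope of the constant sequence `N` with that of `X` modulo `P`, and the second
one makes the telescope of `X` vanish. -/
theorem prop_of_prop_leftAdjoint_obj [HasCoproductsOfShape ℕ T] {C : Type*} [Category* C]
    [Preadditive C] {F : C ⥤ T} {G : T ⥤ C} (adj : F ⊣ G) [G.Additive]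
    [G.ReflectsIsomorphisms] [PreservesColimitsOfShape (Discrete ℕ) G] (P : ObjectProperty T)
    [P.IsTriangulated] [P.IsClosedUnderIsomorphisms]
    [P.IsClosedUnderColimitsOfShape (Discrete ℕ)] (hP : ∀ X, P (F.obj X)) (N : T) : P N := by
  have step : ∀ Y : T, ∃ (Y' : T) (y : Y ⟶ Y'), P.trW y ∧ G.map y = 0 := by
    intro Y
    obtain ⟨Y', y, w, hT⟩ :=
      distinguished_cocone_triangle (show F.obj (G.obj Y) ⟶ Y from adj.counit.app Y)
    refine ⟨Y', y, ?_, ?_⟩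
    · exact (P.trW_iff_of_distinguished' _ hT).2 (hP _)
    · have h₀ : adj.counit.app Y ≫ y = 0 := comp_distTriang_mor_zero₁₂ _ hT
      have h₁ : adj.unit.app (G.obj Y) ≫ G.map (adj.counit.app Y) = 𝟙 (G.obj Y) :=
        adj.right_triangle_components Y
      rw [← Category.id_comp (G.map y), ← h₁, Category.assoc,
        ← G.map_comp, h₀, G.map_zero, comp_zero]
  choose c x hxW hxG using step
  let X : ℕ → T := fun n => Nat.rec N (fun _ Y => c Y) n
  let x' : ∀ n, X n ⟶ X (n + 1) := fun n => x (X n)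
  let f : ∀ n, N ⟶ X n := fun n => Nat.rec (𝟙 N) (fun n g => g ≫ x' n) n
  have hf : ∀ n, P.trW (f n) := by
    intro n
    induction n with
    | zero => exact MorphismProperty.id_mem _ _
    | succ n ih => exact MorphismProperty.comp_mem _ _ _ ih (hxW _)
  let Z : ℕ → T := fun _ => N
  let φ : ∐ Z ⟶ ∐ X := Limits.Sigma.map f
  let τ : ∐ Z ⟶ ∐ Z := Sigma.desc fun n => Sigma.ι Z (n + 1)
  let σ : ∐ X ⟶ ∐ X := Sigma.desc fun n => x' n ≫ Sigma.ι X (n + 1)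
  have hτ : ∀ n, Sigma.ι Z n ≫ τ = Sigma.ι Z (n + 1) := fun n => by simp [τ]
  have hσ : ∀ n, Sigma.ι X n ≫ σ = x' n ≫ Sigma.ι X (n + 1) := fun n => by simp [σ]
  have hGσ : G.map σ = 0 := by
    refine Cofan.IsColimit.hom_ext (isColimitCofanMkObjOfIsColimit G _ _
      (coproductIsCoproduct X)) _ _ fun n => ?_
    dsimp
    rw [← G.map_comp, hσ, G.map_comp, hxG, zero_comp, comp_zero]
  have : IsIso (𝟙 (∐ X) - σ) := by
    have : IsIso (G.map (𝟙 (∐ X) - σ)) := by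
      rw [G.map_sub, hGσ, G.map_id, sub_zero]
      infer_instance
    exact isIso_of_reflects_iso _ G
  have comm : (𝟙 _ - τ) ≫ φ = φ ≫ (𝟙 _ - σ) := by
    ext n
    rw [Preadditive.sub_comp, Preadditive.comp_sub, Preadditive.comp_sub, Preadditive.comp_sub,
      reassoc_of% (hτ n), Category.id_comp, Category.comp_id, Sigma.ι_map, Sigma.ι_map,
      Sigma.ι_map_assoc, hσ, ← Category.assoc]
  have hφ : P.trW φ := trW_sigmaMap P f hf
  have hτW : P.trW (𝟙 _ - τ) := by
    refine trW_of_comp_of_trW P _ φ hφ ?_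
    rw [comm]
    exact MorphismProperty.comp_mem _ _ _ hφ (P.trW_of_isIso _)
  have hι : ∀ n, Sigma.ι Z n ≫ (𝟙 _ - τ) = Sigma.ι Z n - Sigma.ι Z (n + 1) := fun n => by
    rw [Preadditive.comp_sub, hτ, Category.comp_id]
  -- `1 - τ` is split by `ιₙ ↦ -(ι₀ + … + ιₙ₋₁)`, and its cokernel is the codiagonal.
  let r : ∐ Z ⟶ ∐ Z := Sigma.desc fun n => -∑ k ∈ Finset.range n, Sigma.ι Z k
  let q : ∐ Z ⟶ N := Sigma.desc fun _ => 𝟙 N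
  have hr : ∀ n, Sigma.ι Z n ≫ r = -∑ k ∈ Finset.range n, Sigma.ι Z k := fun n => by simp [r]
  have hq : ∀ n, Sigma.ι Z n ≫ q = 𝟙 N := fun n => by simp [q]
  refine prop_of_trW_of_split P (𝟙 _ - τ) r q (Sigma.ι Z 0) ?_ (hq 0) ?_ hτW
  · ext n
    rw [reassoc_of% (hι n), Preadditive.sub_comp, hr, hr, Finset.sum_range_succ, Category.comp_id]
    abel
  · ext n
    rw [Preadditive.comp_add, reassoc_of% (hr n), reassoc_of% (hq n), Preadditive.neg_comp,
      Preadditive.sum_comp, Category.comp_id]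
    simp only [hι]
    rw [Finset.sum_range_sub', neg_sub, Category.id_comp, sub_add_cancel]

end Triangulated

/-! ### Coproducts in the derived category -/

section Coproducts

open Limits HomologicalComplex

/-- The complex in the functor category `J ⥤ C` corresponding to a functor from `J` to
complexes in `C`. -/
def complexOfFunctors {J C ι : Type*} [Category* J] [Category* C] [HasZeroMorphisms C]
    {c : ComplexShape ι} (F : J ⥤ HomologicalComplex C c) : HomologicalComplex (J ⥤ C) c where
  X i := F ⋙ eval C c i
  d i k :=
    { app := fun j => (F.obj j).d i k
      naturality := fun _ _ f => (F.map f).comm i k }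
  shape i k h := by
    ext j
    exact (F.obj j).shape i k h
  d_comp_d' i k l _ _ := by
    ext j
    exact (F.obj j).d_comp_d i k l

/-- Colimits of quasi-isomorphisms are quasi-isomorphisms when colimits of the given shape are
exact. -/
lemma quasiIso_colimMap {J C ι : Type*} [Category* J] [Category* C] [Abelian C]
    [HasColimitsOfShape J C] [HasExactColimitsOfShape J C] {c : ComplexShape ι}
    {F G : J ⥤ HomologicalComplex C c} (α : F ⟶ G) (hα : ∀ j, QuasiIso (α.app j)) :
    QuasiIso (colimMap α) := by
  let β : complexOfFunctors F ⟶ complexOfFunctors G :=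
    { f := fun i => Functor.whiskerRight α (eval C c i)
      comm' := fun i k _ => by
        ext j
        exact (α.app j).comm i k }
  have hβ : QuasiIso β := (quasiIso_iff_evaluation β).2 hα
  have : PreservesFiniteLimits (colim (J := J) (C := C)) :=
    HasExactColimitsOfShape.preservesFiniteLimits
  -- In each degree, the cocone `coconeOfHasColimitEval` is given by a colimit in `C`.
  let γ : (coconeOfHasColimitEval F).pt ⟶ (coconeOfHasColimitEval G).pt :=
    (colim.mapHomologicalComplex c).map β
  have hγ : QuasiIso γ :=
    inferInstanceAs (QuasiIso ((colim.mapHomologicalComplex c).map β))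
  let e₁ := (colimit.isColimit F).coconePointUniqueUpToIso (isColimitCoconeOfHasColimitEval F)
  let e₂ := (colimit.isColimit G).coconePointUniqueUpToIso (isColimitCoconeOfHasColimitEval G)
  have comm : colimMap α = e₁.hom ≫ γ ≫ e₂.inv := by
    refine colimit.hom_ext fun j => ?_
    have h₁ : colimit.ι F j ≫ e₁.hom = (coconeOfHasColimitEval F).ι.app j :=
      IsColimit.comp_coconePointUniqueUpToIso_hom _ _ j
    have h₂ : (coconeOfHasColimitEval G).ι.app j ≫ e₂.inv = colimit.ι G j :=
      IsColimit.comp_coconePointUniqueUpToIso_inv _ _ j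
    have h₃ : (coconeOfHasColimitEval F).ι.app j ≫ γ =
        α.app j ≫ (coconeOfHasColimitEval G).ι.app j := by
      ext i
      exact ι_colimMap (Functor.whiskerRight α (eval C c i)) j
    rw [ι_colimMap, reassoc_of% h₁, ← Category.assoc, h₃, Category.assoc, h₂]
  rw [comm]
  infer_instance

lemma quasiIso_sigmaMap {J C ι : Type*} [Category* C] [Abelian C] [HasCoproductsOfShape J C]
    [HasExactColimitsOfShape (Discrete J) C] {c : ComplexShape ι}
    {K L : J → HomologicalComplex C c} (s : ∀ j, K j ⟶ L j) (hs : ∀ j, QuasiIso (s j)) :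
    QuasiIso (Limits.Sigma.map s) :=
  quasiIso_colimMap (F := Discrete.functor K) (G := Discrete.functor L) (Discrete.natTrans fun j => s j.as)
    fun j => hs j.as

/-- A morphism from a coproduct of complexes is null-homotopic if all its components are. -/
lemma nonempty_homotopy_zero_of_sigma {J C : Type*} [Category* C] [Abelian C]
    [HasCoproductsOfShape J C]
    {K : J → CochainComplex C ℤ} {L : CochainComplex C ℤ} (f : ∐ K ⟶ L)
    (hf : ∀ j, Nonempty (Homotopy (Sigma.ι K j ≫ f) 0)) : Nonempty (Homotopy f 0) := by
  let h j := (hf j).some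
  have hh : ∀ j, Sigma.ι K j ≫ f = Homotopy.nullHomotopicMap (h j).hom := by
    intro j
    ext i
    rw [(h j).comm i]
    simp [Homotopy.nullHomotopicMap]
  have hcol := fun i => isColimitCofanMkObjOfIsColimit (eval C (ComplexShape.up ℤ) i) _ _
    (coproductIsCoproduct K)
  let hom : ∀ i k, (∐ K).X i ⟶ L.X k :=
    fun i k => Cofan.IsColimit.desc (hcol i) fun j => (h j).hom i k
  have hhom : ∀ j i k, (Sigma.ι K j).f i ≫ hom i k = (h j).hom i k :=
    fun j i k => Cofan.IsColimit.fac (hcol i) (fun j => (h j).hom i k) j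
  have : f = Homotopy.nullHomotopicMap hom := by
    refine Sigma.hom_ext _ _ fun j => ?_
    rw [hh, Homotopy.comp_nullHomotopicMap]
    congr 1
    ext i k : 2
    exact (hhom j i k).symm
  rw [this]
  refine ⟨Homotopy.nullHomotopy _ fun i k hik => ?_⟩
  refine Cofan.IsColimit.hom_ext (hcol i) _ _ fun j => ?_
  exact (hhom j i k).trans (((h j).zero i k hik).trans comp_zero.symm)

variable {C : Type u} [Category.{v} C] [Abelian C] [HasDerivedCategory.{w} C]

namespace DerivedCategory

lemma Q_map_eq_zero_iff_exists_homotopy {K L : CochainComplex C ℤ} (f : K ⟶ L) :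
    Q.map f = 0 ↔ ∃ (K' : CochainComplex C ℤ) (s : K' ⟶ K), QuasiIso s ∧
      Nonempty (Homotopy (s ≫ f) 0) := by
  constructor
  · intro hf
    have : Qh.map ((HomotopyCategory.quotient C _).map f) =
        Qh.map ((HomotopyCategory.quotient C _).map 0) := by
      rw [← cancel_epi ((quotientCompQhIso C).inv.app K), ← quotientCompQhIso_inv_naturality, hf,
        Functor.map_zero, Functor.map_zero, zero_comp, comp_zero]
    obtain ⟨X, s, hs, hs'⟩ := (MorphismProperty.map_eq_iff_precomp Qh
      (HomotopyCategory.quasiIso C (ComplexShape.up ℤ)) _ _).1 this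
    obtain ⟨K', rfl⟩ := HomotopyCategory.quotient_obj_surjective X
    obtain ⟨s, rfl⟩ := (HomotopyCategory.quotient _ _).map_surjective s
    rw [HomotopyCategory.quotient_map_mem_quasiIso_iff] at hs
    refine ⟨K', s, hs, ⟨HomotopyCategory.homotopyOfEq _ _ ?_⟩⟩
    rw [Functor.map_comp, hs', ← Functor.map_comp, comp_zero]
  · rintro ⟨K', s, hs, ⟨h⟩⟩
    rw [← cancel_epi (Q.map s), ← Q.map_comp, Q_map_eq_of_homotopy C h, Q.map_zero, comp_zero]

variable {J : Type*} [HasCoproductsOfShape J C] [HasExactColimitsOfShape (Discrete J) C]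

/-- The localization functor to the derived category preserves coproducts. -/
noncomputable def isColimitQMapSigma (K : J → CochainComplex C ℤ) :
    IsColimit (Cofan.mk (Q.obj (∐ K)) fun j => Q.map (Sigma.ι K j)) := by
  have hom_ext : ∀ (L : CochainComplex C ℤ) (f : Q.obj (∐ K) ⟶ Q.obj L),
      (∀ j, Q.map (Sigma.ι K j) ≫ f = 0) → f = 0 := by
    intro L f hf
    obtain ⟨L', g, t, ht, rfl⟩ := left_fac f
    have hg : ∀ j, Q.map (Sigma.ι K j ≫ g) = 0 := fun j => by
      rw [← cancel_mono (inv (Q.map t)), Q.map_comp, Category.assoc, hf, zero_comp]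
    simp only [Q_map_eq_zero_iff_exists_homotopy] at hg
    choose K' s hs hh using hg
    have hg : Q.map g = 0 := by
      refine (Q_map_eq_zero_iff_exists_homotopy g).2
        ⟨∐ K', Limits.Sigma.map s, quasiIso_sigmaMap s hs, nonempty_homotopy_zero_of_sigma _ ?_⟩
      intro j
      rw [Sigma.ι_map_assoc]
      exact hh j
    rw [hg, zero_comp]
  have exists_desc : ∀ (L : CochainComplex C ℤ) (f : ∀ j, Q.obj (K j) ⟶ Q.obj L),
      ∃ g : Q.obj (∐ K) ⟶ Q.obj L, ∀ j, Q.map (Sigma.ι K j) ≫ g = f j := by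
    intro L f
    choose K' s hs g hg using fun j => right_fac (f j)
    have hs' : QuasiIso (Limits.Sigma.map s) := quasiIso_sigmaMap s fun j =>
      (isIso_Q_map_iff_quasiIso C _).1 (hs j)
    refine ⟨inv (Q.map (Limits.Sigma.map s)) ≫ Q.map (Sigma.desc g), fun j => ?_⟩
    rw [hg, ← cancel_epi (Q.map (s j)), IsIso.hom_inv_id_assoc, ← Q.map_comp_assoc,
      ← Sigma.ι_map, Q.map_comp_assoc, IsIso.hom_inv_id_assoc, ← Q.map_comp, Sigma.ι_desc]
  have exists_desc' : ∀ (Y : DerivedCategory C) (f : ∀ j, Q.obj (K j) ⟶ Y),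
      ∃ g : Q.obj (∐ K) ⟶ Y, ∀ j, Q.map (Sigma.ι K j) ≫ g = f j := by
    intro Y f
    obtain ⟨g, hg⟩ := exists_desc _ fun j => f j ≫ (Q.objObjPreimageIso Y).inv
    exact ⟨g ≫ (Q.objObjPreimageIso Y).hom, fun j => by simp [reassoc_of% (hg j)]⟩
  choose d hd using exists_desc'
  refine Cofan.IsColimit.mk _ (fun t => d t.pt t.inj) (fun t j => hd _ _ j) fun t m hm => ?_
  rw [← cancel_mono (Q.objObjPreimageIso t.pt).inv, ← sub_eq_zero, ← Preadditive.sub_comp]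
  refine hom_ext _ _ fun j => ?_
  have : Q.map (Sigma.ι K j) ≫ m = t.inj j := hm j
  rw [← Category.assoc, Preadditive.comp_sub, this, hd, sub_self, zero_comp]

variable (C J) in
lemma hasCoproductsOfShape : HasCoproductsOfShape J (DerivedCategory C) where
  has_colimit F := by
    have : HasCoproduct fun j => Q.obj (Q.objPreimage (F.obj ⟨j⟩)) :=
      ⟨_, isColimitQMapSigma _⟩
    exact hasColimit_of_iso (F := Discrete.functor fun j => Q.obj (Q.objPreimage (F.obj ⟨j⟩)))
      (Discrete.natIso fun j => (Q.objObjPreimageIso (F.obj j)).symm)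

end DerivedCategory

end Coproducts

/-! ### Adjunctions between exact functors and derived categories -/

section Adjunctions

open Limits HomologicalComplex

/-- The adjunction between the functors on complexes induced by an adjunction of additive
functors. -/
def adjunctionMapHomologicalComplex {C D ι : Type*} [Category* C] [Category* D] [Preadditive C]
    [Preadditive D] {F : C ⥤ D} {G : D ⥤ C} [F.Additive] [G.Additive] (adj : F ⊣ G)
    (c : ComplexShape ι) : F.mapHomologicalComplex c ⊣ G.mapHomologicalComplex c where
  unit :=
    { app K :=
        { f := fun i => adj.unit.app (K.X i)
          comm' := fun i j _ => (adj.unit.naturality (K.d i j)).symm }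
      naturality K L f := by
        ext i
        exact adj.unit.naturality (f.f i) }
  counit :=
    { app K :=
        { f := fun i => adj.counit.app (K.X i)
          comm' := fun i j _ => (adj.counit.naturality (K.d i j)).symm }
      naturality K L f := by
        ext i
        exact adj.counit.naturality (f.f i) }
  left_triangle_components K := by
    ext i
    exact adj.left_triangle_components (K.X i)
  right_triangle_components K := by
    ext i
    exact adj.right_triangle_components (K.X i)

section

variable {C D : Type*} [Category* C] [Abelian C] [HasDerivedCategory C]
  [Category* D] [Abelian D] [HasDerivedCategory D] {F : C ⥤ D} {G : D ⥤ C}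
  [F.Additive] [G.Additive] [PreservesFiniteLimits F] [PreservesFiniteColimits F]
  [PreservesFiniteLimits G] [PreservesFiniteColimits G]

/-- The adjunction between derived categories induced by an adjunction of exact functors. -/
noncomputable def adjunctionMapDerivedCategory (adj : F ⊣ G) :
    F.mapDerivedCategory ⊣ G.mapDerivedCategory :=
  letI : CatCommSq (F.mapHomologicalComplex (ComplexShape.up ℤ)) DerivedCategory.Q
    DerivedCategory.Q F.mapDerivedCategory := ⟨F.mapDerivedCategoryFactors.symm⟩
  letI : CatCommSq (G.mapHomologicalComplex (ComplexShape.up ℤ)) DerivedCategory.Q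
    DerivedCategory.Q G.mapDerivedCategory := ⟨G.mapDerivedCategoryFactors.symm⟩
  (adjunctionMapHomologicalComplex adj (ComplexShape.up ℤ)).localization
    DerivedCategory.Q (HomologicalComplex.quasiIso C (ComplexShape.up ℤ))
    DerivedCategory.Q (HomologicalComplex.quasiIso D (ComplexShape.up ℤ))
    F.mapDerivedCategory G.mapDerivedCategory

variable (G) in
lemma reflectsIsomorphisms_mapDerivedCategory [G.ReflectsIsomorphisms] :
    G.mapDerivedCategory.ReflectsIsomorphisms where
  reflects {X Y} f hf := by
    let e₁ := DerivedCategory.Q.objObjPreimageIso X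
    let e₂ := DerivedCategory.Q.objObjPreimageIso Y
    obtain ⟨K, s, hs, g, hg⟩ := DerivedCategory.right_fac (e₁.hom ≫ f ≫ e₂.inv)
    have hfac : f = e₁.inv ≫ inv (DerivedCategory.Q.map s) ≫ DerivedCategory.Q.map g ≫ e₂.hom := by
      rw [← Category.assoc (inv _), ← hg]
      simp
    have hg' : DerivedCategory.Q.map g = DerivedCategory.Q.map s ≫ e₁.hom ≫ f ≫ e₂.inv := by
      rw [hfac]
      simp
    have h₁ : IsIso (G.mapDerivedCategory.map (DerivedCategory.Q.map g)) := by
      rw [hg']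
      simp only [Functor.map_comp]
      infer_instance
    have h₂ : IsIso (DerivedCategory.Q.map
        ((G.mapHomologicalComplex (ComplexShape.up ℤ)).map g)) := by
      have := G.mapDerivedCategoryFactors_hom_naturality g
      rw [← IsIso.inv_comp_eq] at this
      rw [← this]
      infer_instance
    rw [DerivedCategory.isIso_Q_map_iff_quasiIso,
      quasiIso_map_iff_of_preservesHomology] at h₂
    rw [hfac]
    infer_instance

variable (C) in
/-- The objects of the derived category of `C` that are isomorphic to an injective object of `C`
in degree `0`. -/
def injectiveComplexes : ObjectProperty (DerivedCategory C) :=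
  fun X => ∃ I : C, Injective I ∧ Nonempty (X ≅ (DerivedCategory.singleFunctor C 0).obj I)

lemma injectiveComplexes_mapDerivedCategory_obj (adj : F ⊣ G) {X : DerivedCategory D}
    (hX : injectiveComplexes D X) : injectiveComplexes C (G.mapDerivedCategory.obj X) := by
  obtain ⟨I, hI, ⟨e⟩⟩ := hX
  exact ⟨G.obj I, Injective.injective_of_adjoint adj I,
    ⟨G.mapDerivedCategory.mapIso e ≪≫ (G.mapDerivedCategorySingleFunctor 0).app I⟩⟩

end

lemma IsLocalizingSubcategory.inverseImage {T T' : Type*} [Category* T] [HasZeroObject T]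
    [HasShift T ℤ] [Preadditive T] [∀ n : ℤ, (shiftFunctor T n).Additive] [Pretriangulated T]
    [Category* T'] [HasZeroObject T'] [HasShift T' ℤ] [Preadditive T']
    [∀ n : ℤ, (shiftFunctor T' n).Additive] [Pretriangulated T'] {P : ObjectProperty T'}
    (hP : IsLocalizingSubcategory.{w} P) (F : T ⥤ T') [F.CommShift ℤ] [F.IsTriangulated]
    [F.IsLeftAdjoint] : IsLocalizingSubcategory.{w} (P.inverseImage F) := by
  have := hP.isTriangulated
  have := hP.isClosedUnderIsomorphisms
  have := hP.isClosedUnderCoproducts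
  have : PreservesColimitsOfSize.{w, w} F :=
    (Adjunction.ofIsLeftAdjoint F).leftAdjoint_preservesColimits
  exact ⟨inferInstance, inferInstance, inferInstance⟩

lemma IsLocalizingSubcategory.isClosedUnderCountableCoproducts {T : Type*} [Category* T]
    [HasZeroObject T] [HasShift T ℤ] [Preadditive T] [∀ n : ℤ, (shiftFunctor T n).Additive]
    [Pretriangulated T] {P : ObjectProperty T} (hP : IsLocalizingSubcategory.{w} P) :
    P.IsClosedUnderColimitsOfShape (Discrete ℕ) :=
  have := hP.isClosedUnderCoproducts (ULift.{w} ℕ)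
  .of_equivalence (Discrete.equivalence Equiv.ulift)

variable {C D : Type*} [Category* C] [Abelian C] [HasDerivedCategory C]
  [Category* D] [Abelian D] [HasDerivedCategory D] {F : C ⥤ D} {G : D ⥤ C}
  [F.Additive] [G.Additive]

/-- If `G` is conservative and has `F` as left and right adjoint, generation by injectives passes
from the target of `G` to its source: `F` preserves injectives, and its image generates. -/
lemma localizingClosure_injectiveComplexes_eq_top_of_reflectsIsomorphisms
    (adj : F ⊣ G) (adj' : G ⊣ F)
    [HasCoproductsOfShape ℕ D] [HasExactColimitsOfShape (Discrete ℕ) D] [G.ReflectsIsomorphisms]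
    (hC : localizingClosure.{w} (injectiveComplexes C) = ⊤) :
    localizingClosure.{w} (injectiveComplexes D) = ⊤ := by
  have := adj.leftAdjoint_preservesColimits
  have := adj'.leftAdjoint_preservesColimits
  have := adj.rightAdjoint_preservesLimits
  have := adj'.rightAdjoint_preservesLimits
  have := (adjunctionMapDerivedCategory adj).isLeftAdjoint
  have := (adjunctionMapDerivedCategory adj').isLeftAdjoint
  have : PreservesColimitsOfSize.{0, 0} G.mapDerivedCategory :=
    (adjunctionMapDerivedCategory adj').leftAdjoint_preservesColimits
  have := DerivedCategory.hasCoproductsOfShape D ℕ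
  have := reflectsIsomorphisms_mapDerivedCategory G
  refine eq_top_iff.2 fun N _ P hP hinj => ?_
  have hFP : ∀ X, P (F.mapDerivedCategory.obj X) := fun X =>
    (show localizingClosure.{w} (injectiveComplexes C) X by rw [hC]; trivial)
      _ (hP.inverseImage F.mapDerivedCategory)
      fun Y hY => hinj _ (injectiveComplexes_mapDerivedCategory_obj adj' hY)
  have := hP.isTriangulated
  have := hP.isClosedUnderIsomorphisms
  have := hP.isClosedUnderCountableCoproducts
  exact prop_of_prop_leftAdjoint_obj (adjunctionMapDerivedCategory adj) P hFP N

/-- If `F` is left and right adjoint to `G` and the unit of the first adjunction is a section of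
the counit of the second, generation by injectives passes from the source of `G` to its target:
`G` preserves injectives, and every object is a retract of one in its image. -/
lemma localizingClosure_injectiveComplexes_eq_top_of_retract
    (adj : F ⊣ G) (adj' : G ⊣ F)
    [HasCoproductsOfShape ℕ C] [HasExactColimitsOfShape (Discrete ℕ) C]
    (hretract : ∀ X, adj.unit.app X ≫ adj'.counit.app X = 𝟙 X)
    (hD : localizingClosure.{w} (injectiveComplexes D) = ⊤) :
    localizingClosure.{w} (injectiveComplexes C) = ⊤ := by
  have := adj.leftAdjoint_preservesColimits
  have := adj'.leftAdjoint_preservesColimits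
  have := adj.rightAdjoint_preservesLimits
  have := adj'.rightAdjoint_preservesLimits
  have := (adjunctionMapDerivedCategory adj').isLeftAdjoint
  have := DerivedCategory.hasCoproductsOfShape C ℕ
  refine eq_top_iff.2 fun X _ P hP hinj => ?_
  have hGP : ∀ N, P (G.mapDerivedCategory.obj N) := fun N =>
    (show localizingClosure.{w} (injectiveComplexes D) N by rw [hD]; trivial)
      _ (hP.inverseImage G.mapDerivedCategory)
      fun Y hY => hinj _ (injectiveComplexes_mapDerivedCategory_obj adj hY)
  have := hP.isTriangulated
  have := hP.isClosedUnderIsomorphisms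
  have := hP.isClosedUnderCountableCoproducts
  let c := ComplexShape.up ℤ
  let K := DerivedCategory.Q.objPreimage X
  refine P.prop_of_iso (DerivedCategory.Q.objObjPreimageIso X) ?_
  refine prop_of_retract_of_countable_coproducts P
    (DerivedCategory.Q.map ((adjunctionMapHomologicalComplex adj c).unit.app K))
    (DerivedCategory.Q.map ((adjunctionMapHomologicalComplex adj' c).counit.app K)) ?_
    (P.prop_of_iso (G.mapDerivedCategoryFactors.app ((F.mapHomologicalComplex c).obj K)) (hGP _))
  rw [← Functor.map_comp, ← DerivedCategory.Q.map_id]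
  congr 1
  ext i
  exact hretract (K.X i)

end Adjunctions

/-! ### Frobenius extensions of rings -/

section Frobenius

/-- A Frobenius system for a ring homomorphism `f : A →+* B`: an `A`-bimodule homomorphism
`E : B → A` together with dual bases `x` and `y` for the pairing `(b, b') ↦ E (b * b')`. -/
structure FrobeniusSystem {A B : Type*} [Ring A] [Ring B] (f : A →+* B) (ι : Type*)
    [Fintype ι] where
  E : B →+ A
  E_map_mul : ∀ a b, E (f a * b) = a * E b
  E_mul_map : ∀ a b, E (b * f a) = E b * a
  x : ι → B
  y : ι → B
  sum_x_mul : ∀ b, ∑ i, x i * f (E (y i * b)) = b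
  sum_mul_y : ∀ b, ∑ i, f (E (b * x i)) * y i = b

namespace FrobeniusSystem

/-- The opposite of a Frobenius system, in which the dual bases are exchanged. -/
def op {A B ι : Type*} [Ring A] [Ring B] [Fintype ι] {f : A →+* B} (S : FrobeniusSystem f ι) :
    FrobeniusSystem (RingHom.op f) ι where
  E := AddMonoidHom.mulOp S.E
  E_map_mul a b := MulOpposite.unop_injective (S.E_mul_map a.unop b.unop)
  E_mul_map a b := MulOpposite.unop_injective (S.E_map_mul a.unop b.unop)
  x i := .op (S.y i)
  y i := .op (S.x i)
  sum_x_mul b := MulOpposite.unop_injective (by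
    simpa [Finset.unop_sum] using S.sum_mul_y b.unop)
  sum_mul_y b := MulOpposite.unop_injective (by
    simpa [Finset.unop_sum] using S.sum_x_mul b.unop)

section Modules

variable {A B ι : Type*} [Ring A] [Ring B] [Fintype ι] {f : A →+* B} (S : FrobeniusSystem f ι)
  {M N : Type*} [AddCommGroup M] [Module A M] [AddCommGroup N] [Module B N]

lemma sum_x_smul_apply_y_mul (g : B →+ N) (hg : ∀ a b, g (f a * b) = f a • g b) (b : B) :
    ∑ i, S.x i • g (S.y i * b) = b • ∑ i, S.x i • g (S.y i) := by
  calc ∑ i, S.x i • g (S.y i * b)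
    _ = ∑ i, ∑ k, (S.x i * f (S.E (S.y i * (b * S.x k)))) • g (S.y k) := by
      refine Finset.sum_congr rfl fun i _ => ?_
      conv_lhs => rw [← S.sum_mul_y (S.y i * b), map_sum, Finset.smul_sum]
      refine Finset.sum_congr rfl fun k _ => ?_
      rw [hg, mul_smul, mul_assoc]
    _ = ∑ k, (b * S.x k) • g (S.y k) := by
      rw [Finset.sum_comm]
      refine Finset.sum_congr rfl fun k _ => ?_
      rw [← Finset.sum_smul, S.sum_x_mul]
    _ = _ := by
      rw [Finset.smul_sum]
      exact Finset.sum_congr rfl fun k _ => mul_smul _ _ _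

lemma sum_E_mul_x_smul_apply_y (g : B →+ M) (hg : ∀ a b, g (f a * b) = a • g b) (b : B) :
    ∑ i, S.E (b * S.x i) • g (S.y i) = g b := by
  conv_rhs => rw [← S.sum_mul_y b, map_sum]
  exact Finset.sum_congr rfl fun i _ => (hg _ _).symm

lemma sum_x_smul_E_y_smul (n : N) : ∑ i, S.x i • f (S.E (S.y i)) • n = n := by
  have := S.sum_x_mul 1
  simp only [mul_one] at this
  simp only [← mul_smul]
  rw [← Finset.sum_smul, this, one_smul]

end Modules

open ModuleCat

variable {A B : Type u} {ι : Type*} [Ring A] [Ring B] [Fintype ι] {f : A →+* B}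
  (S : FrobeniusSystem f ι)

variable (f) in
/-- The additive map underlying an element of the coextension of scalars of `M`. -/
noncomputable def coextendApply (M : ModuleCat.{u} A) :
    (coextendScalars.{u, u, u} f).obj M →+ (B →+ M) where
  toFun g := (CoextendScalars.equiv f M g).toAddMonoidHom
  map_zero' := rfl
  map_add' _ _ := rfl

variable (f) in
lemma coextendApply_map_mul (M : ModuleCat.{u} A) (g : (coextendScalars.{u, u, u} f).obj M)
    (a : A) (b : B) : coextendApply f M g (f a * b) = a • coextendApply f M g b :=
  (CoextendScalars.equiv f M g).map_smul a b

/-- The map `m ↦ (b ↦ E b • m)`. -/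
noncomputable def unitApp (M : ModuleCat.{u} A) :
    M ⟶ (restrictScalars f).obj ((coextendScalars.{u, u, u} f).obj M) :=
  ofHom (Y := (restrictScalars f).obj ((coextendScalars.{u, u, u} f).obj M))
    { toFun m := (CoextendScalars.equiv f M).symm
        { toFun b := S.E b • m
          map_add' (b b' : B) := by
            change S.E (b + b') • m = S.E b • m + S.E b' • m
            rw [map_add, add_smul]
          map_smul' (a : A) (b : B) := by
            change S.E (f a * b) • m = a • S.E b • m
            rw [S.E_map_mul, mul_smul] }
      map_add' m m' := CoextendScalars.ext <| LinearMap.ext fun b => smul_add (S.E b) m m'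
      map_smul' a m := CoextendScalars.ext <| LinearMap.ext fun (b : B) => by
        change S.E b • a • m = S.E (b * f a) • m
        rw [S.E_mul_map, mul_smul] }

/-- The map `g ↦ ∑ i, x i • g (y i)`. -/
noncomputable def counitApp (N : ModuleCat.{u} B) :
    (coextendScalars.{u, u, u} f).obj ((restrictScalars f).obj N) ⟶ N :=
  ofHom
    { toFun g := ∑ i, S.x i • (coextendApply f _ g : B →+ N) (S.y i)
      map_add' _ _ := (Finset.sum_congr rfl fun i _ => smul_add (S.x i) _ _).trans
        Finset.sum_add_distrib
      map_smul' b g := S.sum_x_smul_apply_y_mul (coextendApply f _ g : B →+ N)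
        (coextendApply_map_mul f _ g) b }

/-- For a ring homomorphism with a Frobenius system, coextension of scalars is left adjoint to
restriction of scalars. -/
noncomputable def adjunction :
    coextendScalars.{u, u, u} f ⊣ restrictScalars.{u, u, u} f where
  unit :=
    { app := S.unitApp
      naturality M M' g := by
        ext m
        exact CoextendScalars.ext <| LinearMap.ext fun b => (g.hom.map_smul (S.E b) m).symm }
  counit :=
    { app := S.counitApp
      naturality N N' g := by
        ext φ
        let ψ : B →+ N := coextendApply f _ φ
        change ∑ i, S.x i • g.hom (ψ (S.y i)) = g.hom (∑ i, S.x i • ψ (S.y i))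
        rw [map_sum]
        exact Finset.sum_congr rfl fun i _ => (g.hom.map_smul _ _).symm }
  left_triangle_components M := by
    ext φ (b : B)
    refine Eq.trans ?_ (S.sum_E_mul_x_smul_apply_y (coextendApply f M φ)
      (coextendApply_map_mul f M φ) b)
    exact map_sum ((AddMonoidHom.eval b).comp (coextendApply f M)) _ _
  right_triangle_components N := by
    ext n
    exact S.sum_x_smul_E_y_smul (N := N) n

lemma unit_app_comp_counit_app (hE : S.E 1 = 1) (M : ModuleCat.{u} A) :
    S.adjunction.unit.app M ≫ (restrictCoextendScalarsAdj.{u, u, u} f).counit.app M = 𝟙 M := by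
  ext m
  change S.E 1 • m = m
  rw [hE, one_smul]

end FrobeniusSystem

end Frobenius

/-! ### Strongly graded rings -/

section StronglyGraded

lemma IsStronglyGraded.exists_sum_mul_eq_one {Γ R : Type*} [AddGroup Γ] [Ring R]
    {𝒜 : Γ → AddSubgroup R} [SetLike.GradedMonoid 𝒜] (h𝒜 : IsStronglyGraded 𝒜) (γ : Γ) :
    ∃ (n : ℕ) (x y : Fin n → R), (∀ i, x i ∈ 𝒜 (-γ)) ∧ (∀ i, y i ∈ 𝒜 γ) ∧
      ∑ i, x i * y i = 1 := by
  have h1 : (1 : R) ∈ AddSubgroup.closure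
      (Set.image2 (fun x y : R => x * y) (𝒜 (-γ)) (𝒜 γ)) := by
    rw [h𝒜, neg_add_cancel]
    exact SetLike.GradedOne.one_mem
  generalize (1 : R) = r at h1 ⊢
  induction h1 using AddSubgroup.closure_induction with
  | mem r hr =>
    obtain ⟨x, hx, y, hy, rfl⟩ := hr
    exact ⟨1, fun _ => x, fun _ => y, fun _ => hx, fun _ => hy, by simp⟩
  | zero => exact ⟨0, Fin.elim0, Fin.elim0, fun i => i.elim0, fun i => i.elim0, by simp⟩
  | add r s _ _ hr hs =>
    obtain ⟨n, x, y, hx, hy, rfl⟩ := hr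
    obtain ⟨m, x', y', hx', hy', rfl⟩ := hs
    refine ⟨n + m, Fin.append x x', Fin.append y y', fun i => ?_, fun i => ?_, ?_⟩
    · induction i using Fin.addCases <;> simp [hx, hx']
    · induction i using Fin.addCases <;> simp [hy, hy']
    · simp [Fin.sum_univ_add]
  | neg r _ hr =>
    obtain ⟨n, x, y, hx, hy, rfl⟩ := hr
    exact ⟨n, fun i => -x i, y, fun i => neg_mem (hx i), hy, by simp⟩

open DirectSum in
/-- The inclusion of the degree `0` part of a strongly graded ring, for a finite group, has a
Frobenius system: `E` is the projection to degree `0`, and the dual bases are obtained from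
expressions of `1` as an element of `R_{-γ} · R_γ` for all `γ`. -/
lemma IsStronglyGraded.exists_frobeniusSystem {Γ : Type*} [AddCommGroup Γ] [Fintype Γ]
    [DecidableEq Γ] {R : Type*} [Ring R] {𝒜 : Γ → AddSubgroup R} [GradedRing 𝒜]
    (h𝒜 : IsStronglyGraded 𝒜) :
    ∃ (n : Γ → ℕ) (S : FrobeniusSystem (SetLike.GradeZero.subring 𝒜).subtype
      (Σ γ, Fin (n γ))), S.E 1 = 1 := by
  choose n x y hx hy hxy using h𝒜.exists_sum_mul_eq_one
  let E : R →+ 𝒜 0 := (DFinsupp.evalAddMonoidHom 0).comp (decomposeAddEquiv 𝒜).toAddMonoidHom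
  have hsum : ∀ r : R, ∑ γ, (decompose 𝒜 r γ : R) = r := fun r => by
    classical
    conv_rhs => rw [← sum_support_decompose 𝒜 r]
    refine (Finset.sum_subset (Finset.subset_univ _) fun γ _ hγ => ?_).symm
    rw [DFinsupp.notMem_support_iff.1 hγ, ZeroMemClass.coe_zero]
  refine ⟨n,
    { E := E
      E_map_mul := fun a r => Subtype.ext (coe_decompose_mul_of_left_mem_zero 𝒜 a.2)
      E_mul_map := fun a r => Subtype.ext (coe_decompose_mul_of_right_mem_zero 𝒜 a.2)
      x := fun i => x i.1 i.2
      y := fun i => y i.1 i.2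
      sum_x_mul := fun r => ?_
      sum_mul_y := fun r => ?_ }, ?_⟩
  · rw [Fintype.sum_sigma, ← Equiv.sum_comp (Equiv.neg Γ)]
    conv_rhs => rw [← hsum r]
    refine Finset.sum_congr rfl fun γ _ => ?_
    have : ∀ i, (decompose 𝒜 (y (-γ) i * r) 0 : R) = y (-γ) i * decompose 𝒜 r γ := fun i => by
      have := coe_decompose_mul_add_of_left_mem 𝒜 (j := γ) (b := r) (hy (-γ) i)
      rwa [neg_add_cancel] at this
    change ∑ i, x (-γ) i * (decompose 𝒜 (y (-γ) i * r) 0 : R) = _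
    simp only [this, ← mul_assoc]
    rw [← Finset.sum_mul, hxy, one_mul]
  · rw [Fintype.sum_sigma]
    conv_rhs => rw [← hsum r]
    refine Finset.sum_congr rfl fun γ _ => ?_
    have : ∀ i, (decompose 𝒜 (r * x γ i) 0 : R) = decompose 𝒜 r γ * x γ i := fun i => by
      have := coe_decompose_mul_add_of_right_mem 𝒜 (i := γ) (a := r) (hx γ i)
      rwa [add_neg_cancel] at this
    change ∑ i, (decompose 𝒜 (r * x γ i) 0 : R) * y γ i = _
    simp only [this, mul_assoc]
    rw [← Finset.mul_sum, hxy, mul_one]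
  · exact Subtype.ext (decompose_of_mem_same 𝒜 SetLike.GradedOne.one_mem)

attribute [local instance] HasDerivedCategory.standard

/-- Generation by injectives can be transferred along a Frobenius extension that splits as a
homomorphism of bimodules. -/
theorem FrobeniusSystem.injectivesGenerate_iff {A B : Type u} {ι : Type*} [Ring A] [Ring B]
    [Fintype ι] {f : A →+* B} (S : FrobeniusSystem f ι) (hE : S.E 1 = 1) :
    InjectivesGenerate B ↔ InjectivesGenerate A := by
  -- Right modules are left modules over the opposite rings.
  let adj := S.op.adjunction
  let adj' := ModuleCat.restrictCoextendScalarsAdj.{u, u, u} (RingHom.op f)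
  have hE' : S.op.E 1 = 1 := congrArg MulOpposite.op hE
  have : (ModuleCat.coextendScalars.{u, u, u} (RingHom.op f)).Additive :=
    adj'.right_adjoint_additive
  exact ⟨localizingClosure_injectiveComplexes_eq_top_of_retract adj adj'
      (S.op.unit_app_comp_counit_app hE'),
    localizingClosure_injectiveComplexes_eq_top_of_reflectsIsomorphisms adj adj'⟩

end StronglyGraded

theorem mainTheorem11 {Γ : Type v} [AddCommGroup Γ] [Finite Γ] [DecidableEq Γ]
    {R : Type u} [Ring R] (𝒜 : Γ → AddSubgroup R) [GradedRing 𝒜]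
    (h𝒜 : IsStronglyGraded 𝒜) :
    InjectivesGenerate R ↔ InjectivesGenerate (𝒜 0) := by
  have := Fintype.ofFinite Γ
  obtain ⟨n, S, hS⟩ := h𝒜.exists_frobeniusSystem
  exact S.injectivesGenerate_iff hS
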